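/- Work with formal series in $\mathbb{Q}((q))[[z]]$; sums of families of such series are taken coefficientwise in the monomials $z^rq^N$, each monomial receiving only finitely many nonzero contributions. **The generating function.** Let $n\ge 1$ and let $k_0,\dots,k_n$ be nonnegative integers. Consider partitions whose parts carry one of the colours $1,\dots,2n-1$, where parts of even colour are odd and parts of odd colour are even. For such a coloured partition $\lambda$ let $f_i^{(c)}$ be the number of parts of size $i\ge 1$ and colour $c$, and put $f_{-1}^{(2c)}:=k_c$ for $1\le c\le n-1$ and $f_0^{(2c-1)}:=k_0\delta_{c,1}+k_n\delta_{c,n}$ for $1\le c\le n$. Then $\lambda$ is admissible if $$\sum_{c=1}^{2n-1} f_{i_c}^{(c)}\le k_0+\dots+k_n$$ for all integer sequences $(i_1,\dots,i_{2n-1})$ with $i_c\ge -1$, $i_c+c$ odd and $|i_c-i_{c+1}|=1$. Let $$\mathcal{D}^{(n)}_{k_0\Lambda_0+\dots+k_n\Lambda_n}(z,q):=\sum_{\lambda} z^{l(\lambda)}q^{|\lambda|},$$ where the sum is over all admissible $\lambda$, $l(\lambda)$ is the number of parts of $\lambda$, and $|\lambda|$ is their sum. **The Hall--Littlewood summands.**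 Let $(a;t)_m:=\prod_{j=0}^{m-1}(1-at^j)$ for $m\ge 0$, let $1/(t;t)_m:=0$ for $m<0$, and let $\genfrac{[}{]}{0pt}{}{m}{l}_t:=\frac{(t;t)_m}{(t;t)_l(t;t)_{m-l}}$ if $0\le l\le m$ and $0$ otherwise. For $k,n\ge 1$ let $S_{k,n}$ be the set of sequences $0=\mu^{(n)}\subseteq\dots\subseteq\mu^{(1)}\subseteq\mu^{(0)}$ of partitions, ordered by inclusion of Young diagrams, such that $\mu^{(0)}$ has at most $2k$ parts and all parts of its conjugate are even. For $\boldsymbol{\mu}\in S_{k,n}$ and $t:=q^n$ let $$\mathrm{HL}_{k,n;\boldsymbol{\mu}}(z,q):=\prod_{i=1}^{2k}\Bigg\{\frac{(zq)^{\frac12\mu^{(0)}_i}}{(t;t)_{\mu^{(0)}_i-\mu^{(0)}_{i+1}}}\prod_{a=1}^n q^{\mu^{(a)}_i}\,t^{\binom{\mu^{(a-1)}_i-\mu^{(a)}_i}{2}}\genfrac{[}{]}{0pt}{}{\mu^{(a-1)}_i-\mu^{(a)}_{i+1}}{\mu^{(a-1)}_i-\mu^{(a)}_i}_t\Bigg\}.$$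 **Theorem.** The generating function $\mathcal{D}^{(2)}_{\Lambda_1}(z,q)$ (that is, $n=2$ and $(k_0,k_1,k_2)=(0,1,0)$) satisfies $$\sum_{\boldsymbol{\mu}\in S_{1,2}} q^{2\mu^{(0)}_1-2\mu^{(1)}_1}\,\mathrm{HL}_{1,2;\boldsymbol{\mu}}(z/q,q)=\mathcal{D}^{(2)}_{\Lambda_1}(z,q),$$ and, explicitly, $$\mathcal{D}^{(2)}_{\Lambda_1}(z,q)=\sum_{r_1,r_2,r_3\ge 0}\frac{z^{r_1}q^{(r_1-r_2)^2+(r_1-r_3)^2+r_2^2+r_3^2-r_2+r_3}}{(q^2;q^2)_{r_1-r_2}\,(q^2;q^2)_{r_2-r_3}\,(q^2;q^2)_{r_3}}.$$ -/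

import Mathlib

open scoped LaurentSeries PowerSeries

namespace CMPP

/-! ### Formal series

All generating functions live in `ℚ((q))[[z]]`, i.e. in `PowerSeries ℚ⸨X⸩`: the variable of the
outer power series ring is `z`, and the variable of the coefficient field is `q`. -/

/-- The variable `q` of the coefficient field `ℚ((q))`. -/
noncomputable def q : ℚ⸨X⸩ := HahnSeries.single 1 1

/-- `F` is the sum of the family `f` in `ℚ((q))[[z]]`, as a formal sum: each monomial `z ^ r q ^ N`
occurs in only finitely many members of the family, and its coefficients there add up to its
coefficient in `F`. -/
def HasFormalSum {ι : Type*} (f : ι → ℚ⸨X⸩⟦X⟧) (F : ℚ⸨X⸩⟦X⟧) : Prop :=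
  ∀ (r : ℕ) (N : ℤ),
    {i | (PowerSeries.coeff r (f i)).coeff N ≠ 0}.Finite ∧
    ∑ᶠ i, (PowerSeries.coeff r (f i)).coeff N = (PowerSeries.coeff r F).coeff N

/-- The substitution `z ↦ z / q` in `ℚ((q))[[z]]`. -/
noncomputable def substZDivQ (F : ℚ⸨X⸩⟦X⟧) : ℚ⸨X⸩⟦X⟧ := PowerSeries.rescale (q⁻¹) F

/-! ### Coloured partitions of type `D` -/

/-- A partition into parts with `m` colours, as the multiset of its parts; `(i, c)` is a part of
size `i` and colour `c + 1`. -/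
abbrev ColouredParts (m : ℕ) := Multiset (ℕ × Fin m)

/-- The sum `|lam|` of the parts. -/
def size {m : ℕ} (lam : ColouredParts m) : ℕ := (lam.map Prod.fst).sum

/-- The number `l(lam)` of parts. -/
def numParts {m : ℕ} (lam : ColouredParts m) : ℕ := Multiset.card lam

/-- The entry of the frequency array of type `D`, with boundary values `k 0, …, k n`,
in the row of colour `c + 1` and in column `i = j - 1 ≥ -1` (columns are shifted by one, so that
they are indexed by natural numbers):
* column `i = -1` has the entry `k_a` for the colour `2 a` (`1 ≤ a ≤ n - 1`);
* column `i = 0` has the entry `k_0` for colour `1`, the entry `k_n` for colour `2 n - 1`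
  (their sum if `n = 1`), and `0` for the other odd colours;
* column `i ≥ 1` holds the multiplicities of the parts of size `i`.
Entries of colour `c + 1` in column `i` with `i + (c + 1)` even lie on no path. -/
def freq {n : ℕ} (k : Fin (n + 1) → ℕ) (lam : ColouredParts (2 * n - 1)) :
    Fin (2 * n - 1) → ℕ → ℕ
  | c, 0 => if Odd c.val then k (Fin.ofNat (n + 1) ((c.val + 1) / 2)) else 0
  | c, 1 => (if c.val = 0 then k 0 else 0) + (if c.val = 2 * n - 2 then k (Fin.last n) else 0)
  | c, i + 2 => lam.count (i + 1, c)

/-- A path on a frequency array of type `D`: `p c - 1 ≥ -1` is the column in which the path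
visits the row of colour `c + 1`. The sum of column and colour is odd, and the columns of
consecutive rows differ by exactly one. -/
def IsPath {m : ℕ} (p : Fin m → ℕ) : Prop :=
  (∀ c : Fin m, Odd (((p c : ℤ) - 1) + ((c.val : ℤ) + 1))) ∧
  ∀ c d : Fin m, d.val = c.val + 1 → |(p c : ℤ) - (p d : ℤ)| = 1

/-- The set `𝒟_{k_0, …, k_n}` of admissible coloured partitions of type `D_{n+1}^{(2)}`. -/
def admissibleD {n : ℕ} (k : Fin (n + 1) → ℕ) : Set (ColouredParts (2 * n - 1)) :=
  {lam | (∀ part ∈ lam, 0 < part.1) ∧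
    (∀ part ∈ lam, Odd (part.1 + (part.2.val + 1))) ∧
    ∀ p : Fin (2 * n - 1) → ℕ, IsPath p → ∑ c, freq k lam c (p c) ≤ ∑ a, k a}

/-- The generating function `𝒟^{(n)}_{k_0 Λ_0 + ⋯ + k_n Λ_n}(z, q)`: the coefficient of
`z ^ r q ^ N` is the number of admissible coloured partitions of `N` with `r` parts. -/
noncomputable def genD {n : ℕ} (k : Fin (n + 1) → ℕ) : ℚ⸨X⸩⟦X⟧ :=
  PowerSeries.mk fun r => HahnSeries.ofPowerSeries ℤ ℚ <| PowerSeries.mk fun N =>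
    (({lam | lam ∈ admissibleD k ∧ numParts lam = r ∧ size lam = N}.ncard : ℕ) : ℚ)

/-- The coefficients of the fundamental weight `Λ_a`. -/
def fundamentalWeight (n : ℕ) (a : Fin (n + 1)) : Fin (n + 1) → ℕ := Pi.single a 1

theorem finite_size_eq {m : ℕ} (N : ℕ) :
    {lam : ColouredParts m | (∀ part ∈ lam, 0 < part.1) ∧ size lam = N}.Finite := by
  refine (Set.finite_Iic
    (N • (Finset.range (N + 1) ×ˢ (Finset.univ : Finset (Fin m))).val)).subset ?_
  rintro lam ⟨hpos, hsize⟩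
  have hle : ∀ part ∈ lam, part.1 ≤ N := fun part hp => by
    rw [← hsize]
    exact Multiset.single_le_sum (fun _ _ => Nat.zero_le _) _ (Multiset.mem_map_of_mem _ hp)
  have hcard : Multiset.card lam ≤ N := by
    rw [← hsize, size, ← Multiset.card_map Prod.fst lam]
    have := Multiset.card_nsmul_le_sum (s := lam.map Prod.fst) (a := 1) (by
      intro x hx
      obtain ⟨y, hy, rfl⟩ := Multiset.mem_map.1 hx
      exact hpos y hy)
    simpa using this
  refine Multiset.le_iff_count.2 fun part => ?_
  by_cases hp : part ∈ lam
  · rw [Multiset.count_nsmul, Multiset.count_eq_one_of_mem (Finset.nodup _) (by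
      have := hle part hp
      simp only [Finset.mem_val, Finset.mem_product, Finset.mem_range, Finset.mem_univ, and_true]
      omega)]
    have := Multiset.count_le_card part lam
    omega
  · simp [Multiset.count_eq_zero_of_notMem hp]

/-- `genD k` is the generating function `∑ z ^ l(lam) q ^ |lam|` over the admissible coloured
partitions. -/
theorem hasFormalSum_genD {n : ℕ} (k : Fin (n + 1) → ℕ) :
    HasFormalSum (fun lam : admissibleD k =>
      PowerSeries.C (q ^ size lam.1) * PowerSeries.X ^ numParts lam.1) (genD k) := by
  classical
  intro r N
  have hterm : ∀ lam : admissibleD k, (PowerSeries.coeff r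
      (PowerSeries.C (q ^ size lam.1) * PowerSeries.X ^ numParts lam.1 : ℚ⸨X⸩⟦X⟧)).coeff N =
      if numParts lam.1 = r ∧ (size lam.1 : ℤ) = N then 1 else 0 := by
    intro lam
    rw [PowerSeries.coeff_C_mul, PowerSeries.coeff_X_pow, q, HahnSeries.single_pow]
    by_cases h1 : numParts lam.1 = r
    · by_cases h2 : (size lam.1 : ℤ) = N
      · simp [h1, ← h2]
      · simp [h1, h2, HahnSeries.coeff_single_of_ne (Ne.symm h2)]
    · simp [h1, Ne.symm h1]
  simp only [hterm]
  have hfin : {lam : admissibleD k | numParts lam.1 = r ∧ (size lam.1 : ℤ) = N}.Finite := by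
    refine Set.Finite.of_finite_image (f := Subtype.val) ?_ Subtype.val_injective.injOn
    refine (finite_size_eq (m := 2 * n - 1) N.toNat).subset ?_
    rintro _ ⟨lam, ⟨-, h⟩, rfl⟩
    exact ⟨lam.2.1, by omega⟩
  refine ⟨by simpa using hfin, ?_⟩
  have hsum : ∑ᶠ lam : admissibleD k,
      (if numParts lam.1 = r ∧ (size lam.1 : ℤ) = N then (1 : ℚ) else 0) =
      (({lam : admissibleD k | numParts lam.1 = r ∧ (size lam.1 : ℤ) = N}.ncard : ℕ) : ℚ) := by
    rw [finsum_eq_sum_of_support_subset (s := hfin.toFinset) _ (by intro lam; simp),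
      Set.ncard_eq_toFinset_card _ hfin, Finset.sum_congr rfl (g := fun _ => (1 : ℚ))]
    · simp
    · intro lam hlam
      rw [if_pos (by simpa using hlam)]
  rw [hsum, ← Set.ncard_image_of_injective _ Subtype.val_injective, genD, PowerSeries.coeff_mk]
  obtain ⟨M, rfl⟩ | hN := (le_or_gt 0 N).imp_left Int.eq_ofNat_of_zero_le
  · rw [HahnSeries.ofPowerSeries_apply_coeff, PowerSeries.coeff_mk]
    congr 2
    ext lam
    simp only [Set.mem_image, Set.mem_ofPred_eq, Subtype.exists, exists_and_right, exists_eq_right,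
      Nat.cast_inj]
    tauto
  · rw [HahnSeries.ofPowerSeries_apply, HahnSeries.embDomain_of_notMem_range]
    · have : {lam : admissibleD k | numParts lam.1 = r ∧ (size lam.1 : ℤ) = N} = ∅ := by
        ext lam
        simp only [Set.mem_ofPred_eq, Set.mem_empty_iff_false, iff_false]
        omega
      simp [this]
    · rintro ⟨M, hM⟩
      have : ((M : ℕ) : ℤ) = N := hM
      omega

/-! ### `q`-shifted factorials and the Hall--Littlewood summands -/

/-- `(a; t)_m = ∏_{j = 0}^{m - 1} (1 - a t ^ j)`. -/
noncomputable def qPochhammer (a t : ℚ⸨X⸩) (m : ℕ) : ℚ⸨X⸩ :=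
  ∏ j ∈ Finset.range m, (1 - a * t ^ j)

/-- `1 / (t; t)_m`, which by convention is `0` for negative `m`. -/
noncomputable def invQFactorial (t : ℚ⸨X⸩) (m : ℤ) : ℚ⸨X⸩ :=
  if 0 ≤ m then (qPochhammer t t m.toNat)⁻¹ else 0

/-- The `t`-binomial coefficient. -/
noncomputable def qBinomial (t : ℚ⸨X⸩) (m l : ℕ) : ℚ⸨X⸩ :=
  if l ≤ m then qPochhammer t t m / (qPochhammer t t l * qPochhammer t t (m - l)) else 0

/-- The set `S_{k,n}` of sequences `0 = μ^(n) ⊆ ⋯ ⊆ μ^(1) ⊆ μ^(0)` of partitions such that all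
parts of the conjugate of `μ^(0)` are even and `μ^(0)` has at most `2 k` parts. -/
def partitionChains (k n : ℕ) : Set (Fin (n + 1) → YoungDiagram) :=
  {μ | Antitone μ ∧ μ (Fin.last n) = ⊥ ∧ (∀ j, Even ((μ 0).colLen j)) ∧ (μ 0).colLen 0 ≤ 2 * k}

/-- The summand `HL_{k,n;μ}(z, q)` for `μ ∈ S_{k,n}`, with `t = q ^ n`. The `i`-th part of a
partition is `rowLen (i - 1)`. The product of the half-integer powers `(z q) ^ (μ^(0)_i / 2)` over
`1 ≤ i ≤ 2 k` is written as a single power; its exponent is an integer since `|μ^(0)|` is even. -/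
noncomputable def hlTerm (k n : ℕ) (μ : Fin (n + 1) → YoungDiagram) : ℚ⸨X⸩⟦X⟧ :=
  (PowerSeries.X * PowerSeries.C q) ^ ((∑ i ∈ Finset.range (2 * k), (μ 0).rowLen i) / 2) *
  PowerSeries.C (∏ i ∈ Finset.range (2 * k),
    ((qPochhammer (q ^ n) (q ^ n) ((μ 0).rowLen i - (μ 0).rowLen (i + 1)))⁻¹ *
      ∏ a : Fin n,
        (q ^ (μ a.succ).rowLen i *
          (q ^ n) ^ ((μ a.castSucc).rowLen i - (μ a.succ).rowLen i).choose 2 *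
          qBinomial (q ^ n) ((μ a.castSucc).rowLen i - (μ a.succ).rowLen (i + 1))
            ((μ a.castSucc).rowLen i - (μ a.succ).rowLen i))))

/-- The weighted summand `q ^ (n μ^(0)_1 - n μ^(1)_1) HL_{1,n;μ}(z / q, q)`, for `n ≥ 1`. -/
noncomputable def weightedHLTerm (n : ℕ) (μ : Fin (n + 1) → YoungDiagram) : ℚ⸨X⸩⟦X⟧ :=
  PowerSeries.C (q ^ ((n : ℤ) * (μ 0).rowLen 0 - (n : ℤ) * (μ (Fin.ofNat (n + 1) 1)).rowLen 0)) *
    substZDivQ (hlTerm 1 n μ)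

/-- The summand of the triple sum, of index `(r 0, r 1, r 2) = (r_1, r_2, r_3)`. -/
noncomputable def tripleTerm (r : Fin 3 → ℕ) : ℚ⸨X⸩⟦X⟧ :=
  PowerSeries.X ^ r 0 *
  PowerSeries.C
    (q ^ (((r 0 : ℤ) - r 1) ^ 2 + ((r 0 : ℤ) - r 2) ^ 2 + (r 1 : ℤ) ^ 2 + (r 2 : ℤ) ^ 2
        - (r 1 : ℤ) + (r 2 : ℤ)) *
      (invQFactorial (q ^ 2) ((r 0 : ℤ) - r 1) * invQFactorial (q ^ 2) ((r 1 : ℤ) - r 2) *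
        invQFactorial (q ^ 2) (r 2 : ℤ)))

end CMPP

/-! For the weight Λ_1 the path sums are bounded by 1. Parity makes |i - j| ≡ |c - d| mod 2 for
parts of sizes i, j and colours c, d, and two distinct parts lie on a common path exactly when |i -
j| ≤ |c - d|. Admissibility therefore means that there are no repeated parts and that any two parts
differ in size by at least 2 + |c - d| (`mem_admissibleD_iff`).

Such partitions are built from the smallest part upwards. Whether a part of least allowed size is
present, together with translation of all sizes by two, gives a first-order recurrence in the number
r of parts (`gapSeries_succ`). The outer colours play symmetric roles, so two unknown series remain,
and eliminating one leaves a three-term recurrence.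

In the triple sum put a = r_1 - r_2, b = r_2 - r_3, c = r_3. The exponent becomes r_1^2 + b(b - 1) +
(a - c)^2, so up to the factor q^(r^2) the coefficient of z^r is that of an Euler series times a
theta-like series. Both satisfy functional equations under z ↦ q²z. Their product yields the same
three-term recurrence, and `ofPowerSeries_gapSeries` compares the two.

Finally, a chain in S_{1,2} consists of μ^(0) = (r_1, r_1), μ^(1) = (r_2, r_3) and the empty
partition. The t-binomials telescope, so the Hall–Littlewood sum is the triple sum term by term
(`weightedHLTerm_eq`), up to indices whose terms vanish. -/

namespace CMPP

/-! ### Coloured partitions with gap conditions -/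

/-- The part `y` exceeds the part `x` by at least two plus the distance of their colours. -/
def GapLT (x y : ℕ × Fin 3) : Prop :=
  x.1 + 2 + x.2.val ≤ y.1 + y.2.val ∧ x.1 + 2 + y.2.val ≤ y.1 + x.2.val

/-- The least size `b + |c - d|` of a part of colour `d`, seen from the colour `c`. -/
def minPart (c : Fin 3) (b : ℕ) (d : Fin 3) : ℕ := b + (c.val - d.val) + (d.val - c.val)

/-- The coloured partitions of `N` into `r` parts, any two of which are separated by a gap, and
such that all parts of colour `d` are at least `minPart c b d`. -/
def gapped (c : Fin 3) (b r N : ℕ) : Set (ColouredParts 3) :=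
  {lam | numParts lam = r ∧ size lam = N ∧ lam.Nodup ∧
    (∀ x ∈ lam, Even (x.1 + x.2.val) ∧ minPart c b x.2 ≤ x.1) ∧
    ∀ x ∈ lam, ∀ y ∈ lam, x ≠ y → GapLT x y ∨ GapLT y x}

theorem finite_gapped {c : Fin 3} {b : ℕ} (hb : 1 ≤ b) (r N : ℕ) : (gapped c b r N).Finite := by
  refine (finite_size_eq N).subset ?_
  rintro lam ⟨-, h, -, hl, -⟩
  refine ⟨fun x hx => ?_, h⟩
  have := (hl x hx).2
  unfold minPart at this
  omega

theorem size_cons {m : ℕ} (x : ℕ × Fin m) (lam : ColouredParts m) :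
    size (x ::ₘ lam) = x.1 + size lam := by simp [size]

/-- By the triangle inequality for colour distances, no other allowed part can lie a gap below a
part of least size. All the others lie a gap above it, and this is the lower bound seen from its
colour `d`. Conversely, the bound from `d` implies the bound from `c`. -/
theorem cons_mem_gapped_iff {c d : Fin 3} {b r N : ℕ} (hp : Even (b + c.val))
    (mu : ColouredParts 3) :
    (minPart c b d, d) ::ₘ mu ∈ gapped c b (r + 1) (minPart c b d + N) ↔
      mu ∈ gapped d (minPart c b d + 2) r N := by
  simp only [gapped, Set.mem_ofPred_eq, numParts, Multiset.card_cons, size_cons,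
    Multiset.nodup_cons, Multiset.mem_cons, add_left_inj, add_right_inj]
  constructor
  · rintro ⟨h1, h2, ⟨h3, h4⟩, h5, h6⟩
    refine ⟨h1, h2, h4, fun x hx => ⟨(h5 x (.inr hx)).1, ?_⟩,
      fun x hx y hy => h6 x (.inr hx) y (.inr hy)⟩
    have hne : x ≠ (minPart c b d, d) := fun h => h3 (h ▸ hx)
    have h7 := h6 x (.inr hx) _ (.inl rfl) hne
    have h8 := (h5 x (.inr hx)).2
    simp only [GapLT, minPart] at *
    omega
  · rintro ⟨h1, h2, h4, h5, h6⟩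
    have key : ∀ x ∈ mu, GapLT (minPart c b d, d) x := fun x hx => by
      have := (h5 x hx).2
      simp only [GapLT, minPart] at *
      omega
    refine ⟨h1, h2, ⟨fun h => ?_, h4⟩, ?_, ?_⟩
    · have := (key _ h).1
      omega
    · rintro x (rfl | hx)
      · refine ⟨?_, le_rfl⟩
        simp only [minPart, Nat.even_iff] at *
        omega
      · refine ⟨(h5 x hx).1, ?_⟩
        have := (h5 x hx).2
        simp only [minPart] at *
        omega
    · rintro x (rfl | hx) y (rfl | hy) hne
      · exact absurd rfl hne
      · exact .inl (key y hy)
      · exact .inr (key x hx)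
      · exact h6 x hx y hy hne

theorem ncard_gapped_of_mem {c d : Fin 3} {b : ℕ} (hp : Even (b + c.val)) (r N : ℕ) :
    {lam ∈ gapped c b (r + 1) N | (minPart c b d, d) ∈ lam}.ncard =
      if minPart c b d ≤ N then (gapped d (minPart c b d + 2) r (N - minPart c b d)).ncard
      else 0 := by
  split_ifs with h
  · obtain ⟨M, rfl⟩ := Nat.exists_eq_add_of_le h
    rw [Nat.add_sub_cancel_left,
      ← Set.ncard_image_of_injective (gapped d _ r M) (f := fun mu => (minPart c b d, d) ::ₘ mu)
        fun _ _ h => (Multiset.cons_inj_right _).1 h]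
    congr 1
    ext lam
    constructor
    · rintro ⟨h1, h2⟩
      obtain ⟨mu, rfl⟩ := Multiset.exists_cons_of_mem h2
      exact ⟨mu, (cons_mem_gapped_iff hp mu).1 h1, rfl⟩
    · rintro ⟨mu, hmu, rfl⟩
      exact ⟨(cons_mem_gapped_iff hp mu).2 hmu, Multiset.mem_cons_self _ _⟩
  · refine (congrArg Set.ncard (Set.eq_empty_of_forall_notMem ?_)).trans (Set.ncard_empty _)
    rintro lam ⟨⟨-, h2, -⟩, hm⟩
    obtain ⟨mu, rfl⟩ := Multiset.exists_cons_of_mem hm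
    rw [size_cons] at h2
    dsimp only at h2
    omega

/-- Parity lets the sizes of a given colour grow only in steps of two, so excluding the least size
raises the bound by two. -/
theorem mem_gapped_add_two_iff {c : Fin 3} {b r N : ℕ} (hp : Even (b + c.val))
    (lam : ColouredParts 3) :
    lam ∈ gapped c (b + 2) r N ↔
      lam ∈ gapped c b r N ∧ ∀ d, (minPart c b d, d) ∉ lam := by
  constructor
  · rintro ⟨h1, h2, h3, h4, h5⟩
    refine ⟨⟨h1, h2, h3, fun x hx => ⟨(h4 x hx).1, ?_⟩, h5⟩, fun d hd => ?_⟩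
    · have := (h4 x hx).2
      simp only [minPart] at *
      omega
    · have := (h4 _ hd).2
      simp only [minPart] at *
      omega
  · rintro ⟨⟨h1, h2, h3, h4, h5⟩, h6⟩
    refine ⟨h1, h2, h3, fun x hx => ⟨(h4 x hx).1, ?_⟩, h5⟩
    obtain ⟨h7, h8⟩ := h4 x hx
    have h9 : x.1 ≠ minPart c b x.2 := fun h => h6 x.2 (h ▸ hx)
    simp only [minPart, Nat.even_iff] at *
    omega

/-- Least sizes for two colours differ by at most the distance of these colours, which is too little
for a gap. -/
theorem minPart_mem_unique {c d d' : Fin 3} {b r N : ℕ} {lam : ColouredParts 3}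
    (hl : lam ∈ gapped c b r N) (h : (minPart c b d, d) ∈ lam) (h' : (minPart c b d', d') ∈ lam) :
    d = d' := by
  by_contra hne
  have := hl.2.2.2.2 _ h _ h' fun h => hne (congrArg Prod.snd h)
  simp only [GapLT, minPart] at this
  omega

/-- Case split: either no part has the least size for its colour, or exactly one does, and it is
removed. -/
theorem ncard_gapped_succ {c : Fin 3} {b : ℕ} (hb : 1 ≤ b) (hp : Even (b + c.val)) (r N : ℕ) :
    (gapped c b (r + 1) N).ncard = (gapped c (b + 2) (r + 1) N).ncard +
      ∑ d, if minPart c b d ≤ N then (gapped d (minPart c b d + 2) r (N - minPart c b d)).ncard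
        else 0 := by
  classical
  have hfin := finite_gapped (c := c) hb (r + 1) N
  simp only [← ncard_gapped_of_mem hp]
  rw [← Set.ncard_inter_add_ncard_sdiff_eq_ncard _ {lam | ∀ d, (minPart c b d, d) ∉ lam} hfin]
  congr 1
  · congr 1
    ext lam
    exact (mem_gapped_add_two_iff hp lam).symm
  · rw [← finsum_eq_sum_of_fintype, ← Set.ncard_iUnion_of_finite]
    · congr 1
      ext lam
      simp
    · exact fun d => hfin.subset fun _ h => h.1
    · intro d d' hne
      exact Set.disjoint_left.2 fun lam h h' => hne (minPart_mem_unique h.1 h.2 h'.2)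

/-- Adding two to the size of a part. -/
def shiftPart (x : ℕ × Fin 3) : ℕ × Fin 3 := (x.1 + 2, x.2)

theorem shiftPart_injective : Function.Injective shiftPart := by
  rintro ⟨i, c⟩ ⟨j, d⟩ h
  simpa [shiftPart] using h

theorem size_map_shiftPart (lam : ColouredParts 3) :
    size (lam.map shiftPart) = size lam + 2 * numParts lam := by
  induction lam using Multiset.induction_on with
  | empty => simp [size, numParts]
  | cons x lam ih =>
    rw [Multiset.map_cons, size_cons, ih, size_cons]
    simp only [numParts, Multiset.card_cons, shiftPart]
    ring

theorem map_shiftPart_mem_gapped_iff {c : Fin 3} {b r N : ℕ} (lam : ColouredParts 3) :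
    lam.map shiftPart ∈ gapped c (b + 2) r (N + 2 * r) ↔ lam ∈ gapped c b r N := by
  have hnum : numParts (lam.map shiftPart) = numParts lam := Multiset.card_map _ _
  have hgap : ∀ x y, GapLT (shiftPart x) (shiftPart y) ↔ GapLT x y := fun x y => by
    simp only [GapLT, shiftPart]
    omega
  simp only [gapped, Set.mem_ofPred_eq, Multiset.nodup_map_iff_of_injective shiftPart_injective,
    size_map_shiftPart, Multiset.mem_map, forall_exists_index, and_imp, forall_apply_eq_imp_iff₂,
    hnum, hgap, shiftPart_injective.ne_iff]
  refine and_congr_right fun h => and_congr (by omega) (and_congr_right fun _ => and_congr_left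
    fun _ => forall₂_congr fun x _ => ?_)
  simp only [shiftPart, minPart, Nat.even_iff]
  omega

theorem ncard_gapped_add_two (c : Fin 3) (b r N : ℕ) :
    (gapped c (b + 2) r N).ncard =
      if 2 * r ≤ N then (gapped c b r (N - 2 * r)).ncard else 0 := by
  -- The truncated subtraction undoes the shift, since every part is at least `b + 2`.
  have hmap : ∀ lam ∈ gapped c (b + 2) r N,
      (lam.map fun x => (x.1 - 2, x.2)).map shiftPart = lam := fun lam h => by
    rw [Multiset.map_map]
    conv_rhs => rw [← Multiset.map_id lam]
    refine Multiset.map_congr rfl fun x hx => ?_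
    have := (h.2.2.2.1 x hx).2
    simp only [minPart] at this
    simp only [Function.comp, shiftPart, id]
    ext
    · dsimp only; omega
    · rfl
  split_ifs with h
  · obtain ⟨M, rfl⟩ := Nat.exists_eq_add_of_le' h
    rw [Nat.add_sub_cancel,
      ← Set.ncard_image_of_injective (gapped c b r M) (Multiset.map_injective shiftPart_injective)]
    congr 1
    ext lam
    constructor
    · intro hl
      refine ⟨_, ?_, hmap lam hl⟩
      rwa [← map_shiftPart_mem_gapped_iff, hmap lam hl]
    · rintro ⟨mu, hmu, rfl⟩
      exact (map_shiftPart_mem_gapped_iff mu).2 hmu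
  · refine (congrArg Set.ncard (Set.eq_empty_of_forall_notMem fun lam hl => ?_)).trans
      (Set.ncard_empty _)
    have h1 := size_map_shiftPart (lam.map fun x => (x.1 - 2, x.2))
    rw [hmap lam hl, hl.2.1, numParts, Multiset.card_map] at h1
    have h2 : Multiset.card lam = r := hl.1
    omega

/-! ### Recurrences for the generating functions of gapped partitions -/

/-- The generating function of `gapped c b r`. -/
noncomputable def gapSeries (c : Fin 3) (b r : ℕ) : ℚ⟦X⟧ :=
  PowerSeries.mk fun N => ((gapped c b r N).ncard : ℚ)

theorem gapSeries_zero (c : Fin 3) (b : ℕ) : gapSeries c b 0 = 1 := by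
  ext N
  rw [gapSeries, PowerSeries.coeff_mk, PowerSeries.coeff_one]
  have h : gapped c b 0 N = if N = 0 then {0} else ∅ := by
    ext lam
    constructor
    · rintro ⟨h1, h2, -⟩
      obtain rfl : lam = 0 := Multiset.card_eq_zero.1 h1
      obtain rfl : N = 0 := by rw [← h2]; rfl
      simp
    · split_ifs with h
      · rintro rfl
        subst h
        simp [gapped, numParts, size]
      · simp
  rw [h]
  split_ifs <;> simp

theorem gapSeries_add_two (c : Fin 3) (b r : ℕ) :
    gapSeries c (b + 2) r = PowerSeries.X ^ (2 * r) * gapSeries c b r := by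
  ext N
  rw [PowerSeries.coeff_X_pow_mul', gapSeries, gapSeries, PowerSeries.coeff_mk,
    PowerSeries.coeff_mk, ncard_gapped_add_two]
  split_ifs <;> simp

/-- The case without a least part is a translate of the whole family by two; moving it to the left
gives the factor `1 - X ^ (2 * (r + 1))`. -/
theorem gapSeries_succ {c : Fin 3} {b : ℕ} (hb : 1 ≤ b) (hp : Even (b + c.val)) (r : ℕ) :
    (1 - PowerSeries.X ^ (2 * (r + 1))) * gapSeries c b (r + 1) =
      ∑ d, PowerSeries.X ^ minPart c b d * gapSeries d (minPart c b d + 2) r := by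
  rw [sub_mul, one_mul, ← gapSeries_add_two, sub_eq_iff_eq_add']
  ext N
  simp only [map_add, map_sum, PowerSeries.coeff_X_pow_mul']
  simp only [gapSeries, PowerSeries.coeff_mk, ncard_gapped_succ hb hp]
  push_cast
  rfl

theorem one_sub_X_pow_ne_zero (r : ℕ) : (1 - PowerSeries.X ^ (2 * (r + 1)) : ℚ⟦X⟧) ≠ 0 := by
  intro h
  simpa [PowerSeries.coeff_X_pow] using congrArg (PowerSeries.coeff 0) h

/-- The recurrence depends on colours only through their distances, hence is invariant under
exchanging the outer colours. -/
theorem gapSeries_two {b : ℕ} (hb : 1 ≤ b) (hp : Even b) (r : ℕ) :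
    gapSeries 2 b r = gapSeries 0 b r := by
  induction r generalizing b with
  | zero => rw [gapSeries_zero, gapSeries_zero]
  | succ r ih =>
    apply mul_left_cancel₀ (one_sub_X_pow_ne_zero r)
    rw [gapSeries_succ hb (hp.add (by decide)), gapSeries_succ hb (hp.add (by decide)),
      Fin.sum_univ_three, Fin.sum_univ_three]
    simp only [minPart, Fin.val_zero, Fin.val_one, Fin.val_two, Nat.sub_self, Nat.zero_sub,
      Nat.sub_zero, add_zero, Nat.reduceSub]
    rw [ih (b := b + 2) (by omega) (by simpa [Nat.even_add] using hp),
      ih (b := b + 2 + 2) (by omega) (by simpa [Nat.even_add] using hp)]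
    ring

/-- With `gapSeries_zero_succ` this is a closed system in `gapSeries 1 1` and `gapSeries 0 2`: the
other series are reduced to these by symmetry and translation. -/
theorem gapSeries_one_succ (r : ℕ) :
    (1 - PowerSeries.X ^ (2 * (r + 1))) * gapSeries 1 1 (r + 1) =
      PowerSeries.X ^ (2 * r) * (PowerSeries.X * gapSeries 1 1 r +
        2 * PowerSeries.X ^ 2 * gapSeries 0 2 r) := by
  rw [gapSeries_succ le_rfl (by decide), Fin.sum_univ_three]
  simp only [minPart, Fin.val_zero, Fin.val_one, Fin.val_two, Nat.sub_self, Nat.zero_sub,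
    Nat.sub_zero, add_zero, Nat.reduceAdd]
  rw [gapSeries_two (b := 4) (by decide) (by decide), gapSeries_add_two 0 2, gapSeries_add_two 1 1]
  ring

theorem gapSeries_zero_succ (r : ℕ) :
    (1 - PowerSeries.X ^ (2 * (r + 1))) * gapSeries 0 2 (r + 1) =
      PowerSeries.X ^ (2 * r) * (PowerSeries.X ^ 2 * gapSeries 0 2 r +
        PowerSeries.X ^ (2 * r) * (PowerSeries.X ^ 3 * gapSeries 1 1 r +
          PowerSeries.X ^ 4 * gapSeries 0 2 r)) := by
  rw [gapSeries_succ (by decide) (by decide), Fin.sum_univ_three]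
  simp only [minPart, Fin.val_zero, Fin.val_one, Fin.val_two, Nat.sub_self, Nat.zero_sub,
    Nat.sub_zero, add_zero, Nat.reduceAdd]
  rw [gapSeries_two (b := 6) (by decide) (by decide), gapSeries_add_two 0 4, gapSeries_add_two 0 2,
    gapSeries_add_two 1 3, gapSeries_add_two 1 1]
  ring

/-! ### Admissible partitions as gapped partitions -/

theorem isPath_three_iff (p : Fin 3 → ℕ) :
    IsPath p ↔ (Odd (p 0) ∧ Even (p 1) ∧ Odd (p 2)) ∧
      (p 0 = p 1 + 1 ∨ p 1 = p 0 + 1) ∧ (p 2 = p 1 + 1 ∨ p 1 = p 2 + 1) := by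
  simp only [IsPath, Fin.forall_fin_succ, IsEmpty.forall_iff, and_true,
    Int.odd_iff, Nat.odd_iff, Nat.even_iff, abs_eq zero_le_one]
  simp
  omega

/-- Without a gap, parity gives |i - j| ≤ |c - d|, so unit steps can join the two parts. Distinct
parts of one colour always have a gap. -/
theorem exists_path {x y : ℕ × Fin 3} (hx : Even (x.1 + x.2.val)) (hy : Even (y.1 + y.2.val))
    (hne : x ≠ y) (h : ¬ GapLT x y) (h' : ¬ GapLT y x) :
    x.2 ≠ y.2 ∧ ∃ p : Fin 3 → ℕ, IsPath p ∧ p x.2 = x.1 + 1 ∧ p y.2 = y.1 + 1 := by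
  obtain ⟨i, c⟩ := x
  obtain ⟨j, d⟩ := y
  have hcd : c ≠ d := by
    rintro rfl
    have : i ≠ j := fun h => hne (by rw [h])
    simp only [GapLT, Nat.even_iff] at *
    omega
  refine ⟨hcd, ?_⟩
  simp only [isPath_three_iff, GapLT, Nat.even_iff, Nat.odd_iff] at *
  fin_cases c <;> fin_cases d <;> simp at hx hy h h' hcd ⊢
  · exact ⟨![i + 1, j + 1, j + 2], by simp; omega⟩
  -- The outer columns are equal or differ by two, so column `min i j + 1` is adjacent to both; path
  -- entries are columns shifted by one.
  · exact ⟨![i + 1, min i j + 2, j + 1], by simp; omega⟩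
  · exact ⟨![j + 1, i + 1, i + 2], by simp; omega⟩
  · exact ⟨![i + 2, i + 1, j + 1], by simp; omega⟩
  · exact ⟨![j + 1, min i j + 2, i + 1], by simp; omega⟩
  · exact ⟨![j + 2, j + 1, i + 1], by simp; omega⟩

theorem exists_path_self {x : ℕ × Fin 3} (hx : Even (x.1 + x.2.val)) :
    ∃ p : Fin 3 → ℕ, IsPath p ∧ p x.2 = x.1 + 1 := by
  obtain ⟨i, c⟩ := x
  simp only [isPath_three_iff, Nat.even_iff, Nat.odd_iff] at *
  fin_cases c <;> simp at hx ⊢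
  · exact ⟨![i + 1, i + 2, i + 1], by simp; omega⟩
  · exact ⟨![i + 2, i + 1, i + 2], by simp; omega⟩
  · exact ⟨![i + 1, i + 2, i + 1], by simp; omega⟩

/-- For Λ_1 the boundary column 0 vanishes, as do multiplicities of parts of size 0, so columns `i ≥
0` need no case distinction. -/
theorem freq_succ (lam : ColouredParts 3) (c : Fin 3) (i : ℕ) (h : (0, c) ∉ lam) :
    freq (n := 2) (fundamentalWeight 2 1) lam c (i + 1) = lam.count (i, c) := by
  cases i with
  | zero =>
    rw [Multiset.count_eq_zero_of_notMem h]
    simp [freq, fundamentalWeight]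
  | succ i => rfl

theorem sum_fundamentalWeight : ∑ a, fundamentalWeight 2 1 a = 1 := by decide

/-- With parity, the lower bounds from colour index 1 and `b = 1` (1 for the middle colour, 2 for
the outer ones) amount to positivity of the parts. -/
theorem mem_admissibleD_iff (lam : ColouredParts 3) :
    lam ∈ admissibleD (n := 2) (fundamentalWeight 2 1) ↔
      lam ∈ gapped 1 1 (numParts lam) (size lam) := by
  have hpar : ∀ x : ℕ × Fin 3, Odd (x.1 + (x.2.val + 1)) ↔ Even (x.1 + x.2.val) := fun x => by
    rw [Nat.odd_iff, Nat.even_iff]; omega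
  simp only [admissibleD, gapped, Set.mem_ofPred_eq, hpar, true_and, sum_fundamentalWeight]
  constructor
  · rintro ⟨h1, h2, h3⟩
    have h0 : ∀ c : Fin 3, (0, c) ∉ lam := fun c h => (h1 _ h).false
    refine ⟨Multiset.nodup_iff_count_le_one.2 ?_, fun x hx => ⟨h2 x hx, ?_⟩, ?_⟩
    · intro x
      by_cases hx : x ∈ lam
      · obtain ⟨p, hp, hpx⟩ := exists_path_self (h2 x hx)
        have h4 := (Finset.single_le_sum (fun _ _ => Nat.zero_le _) (Finset.mem_univ x.2)).trans
          (h3 p hp)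
        rwa [hpx, freq_succ _ _ _ (h0 _)] at h4
      · simp [Multiset.count_eq_zero_of_notMem hx]
    · have := h1 x hx
      have := h2 x hx
      simp only [minPart, Nat.even_iff] at *
      have := x.2.isLt
      simp
      omega
    · intro x hx y hy hne
      by_contra! hgap
      obtain ⟨hc, p, hp, hpx, hpy⟩ := exists_path (h2 x hx) (h2 y hy) hne hgap.1 hgap.2
      have h4 := h3 p hp
      have h5 : ∑ c ∈ {x.2, y.2}, freq (n := 2) (fundamentalWeight 2 1) lam c (p c) ≤ 1 :=
        (Finset.sum_le_sum_of_subset (Finset.subset_univ _)).trans h4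
      rw [Finset.sum_pair hc, hpx, hpy, freq_succ _ _ _ (h0 _), freq_succ _ _ _ (h0 _)] at h5
      have := Multiset.count_pos.2 hx
      have := Multiset.count_pos.2 hy
      simp only [Prod.mk.eta] at h5
      omega
  · rintro ⟨h1, h2, h3⟩
    have hpos : ∀ x ∈ lam, 0 < x.1 := fun x hx => by
      have := (h2 x hx).2
      unfold minPart at this
      omega
    refine ⟨hpos, fun x hx => (h2 x hx).1, fun p hp => ?_⟩
    have h0 : ∀ c : Fin 3, (0, c) ∉ lam := fun c h => (hpos _ h).false
    have hle := Multiset.nodup_iff_count_le_one.1 h1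
    obtain ⟨hodd, h4, h5⟩ := (isPath_three_iff p).1 hp
    have hS : ∑ c, freq (n := 2) (fundamentalWeight 2 1) lam c (p c) =
      freq (n := 2) (fundamentalWeight 2 1) lam (0 : Fin 3) (p 0) +
      freq (n := 2) (fundamentalWeight 2 1) lam (1 : Fin 3) (p 1) +
      freq (n := 2) (fundamentalWeight 2 1) lam (2 : Fin 3) (p 2) := Fin.sum_univ_three _
    rw [hS]
    rcases hp1 : p 1 with _ | j
    -- The path meets the middle row in column -1, where the entry `k 1 = 1` exhausts the bound; its
    -- neighbours are in column 0, where the entries vanish.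
    · have hp0 : p 0 = 0 + 1 := by omega
      have hp2 : p 2 = 0 + 1 := by omega
      rw [hp0, hp2, freq_succ _ _ _ (h0 _), freq_succ _ _ _ (h0 _),
        Multiset.count_eq_zero_of_notMem (h0 _), Multiset.count_eq_zero_of_notMem (h0 _)]
      exact le_rfl
    · obtain ⟨i, hi⟩ : ∃ i, p 0 = i + 1 := ⟨p 0 - 1, by simp only [Nat.odd_iff] at hodd; omega⟩
      obtain ⟨k, hk⟩ : ∃ k, p 2 = k + 1 := ⟨p 2 - 1, by simp only [Nat.odd_iff] at hodd; omega⟩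
      rw [hi, hk, freq_succ _ _ _ (h0 _), freq_succ _ _ _ (h0 _), freq_succ _ _ _ (h0 _)]
      have hexcl : ∀ x y : ℕ × Fin 3, x ≠ y → ¬ GapLT x y → ¬ GapLT y x →
          lam.count x = 0 ∨ lam.count y = 0 := fun x y hne hx hy => by
        simp only [Multiset.count_eq_zero]
        by_contra! hmem
        exact (h3 x hmem.1 y hmem.2 hne).elim hx hy
      -- Positions on one path are too close for a gap, so at most one of the three is occupied.
      have e1 := hexcl (i, 0) (j, 1) (by simp) (by simp [GapLT]; omega) (by simp [GapLT]; omega)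
      have e2 := hexcl (i, 0) (k, 2) (by simp) (by simp [GapLT]; omega) (by simp [GapLT]; omega)
      have e3 := hexcl (j, 1) (k, 2) (by simp) (by simp [GapLT]; omega) (by simp [GapLT]; omega)
      have := hle (i, 0)
      have := hle (j, 1)
      have := hle (k, 2)
      omega

/-! ### The triple sum -/

theorem q_ne_zero : q ≠ 0 := HahnSeries.single_ne_zero one_ne_zero

theorem q_pow_ne_one {m : ℕ} (hm : m ≠ 0) : q ^ m ≠ 1 := by
  intro h
  have := congrArg (fun x : ℚ⸨X⸩ => x.coeff 0) h
  rw [q, HahnSeries.single_pow] at this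
  rw [HahnSeries.coeff_single_of_ne (by simpa using fun h => hm (by exact_mod_cast h.symm))] at this
  simp at this

/-- The `q²`-factorial `(q²; q²)_m`. -/
noncomputable abbrev qFact (m : ℕ) : ℚ⸨X⸩ := qPochhammer (q ^ 2) (q ^ 2) m

theorem qFact_zero : qFact 0 = 1 := by simp [qPochhammer]

theorem qFact_succ (m : ℕ) : qFact (m + 1) = qFact m * (1 - q ^ (2 * (m + 1))) := by
  rw [qFact, qPochhammer, Finset.prod_range_succ]
  congr 2
  ring

theorem one_sub_q_pow_ne_zero (m : ℕ) : 1 - q ^ (2 * (m + 1)) ≠ 0 :=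
  sub_ne_zero.2 (q_pow_ne_one (by omega)).symm

theorem qFact_ne_zero (m : ℕ) : qFact m ≠ 0 := by
  induction m with
  | zero => simp [qFact_zero]
  | succ m ih => rw [qFact_succ]; exact mul_ne_zero ih (one_sub_q_pow_ne_zero m)

theorem one_sub_mul_inv_qFact_succ (m : ℕ) :
    (1 - q ^ (2 * (m + 1))) * (qFact (m + 1))⁻¹ = (qFact m)⁻¹ := by
  rw [qFact_succ, mul_inv, mul_left_comm, mul_inv_cancel₀ (one_sub_q_pow_ne_zero m), mul_one]

/-! ### Theta sums and their contiguous relations -/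

/-- The sum of `q ^ (k ^ 2 + j k) / ((q²; q²)_m (q²; q²)_n)`, with `k = m - n`, over
`m + n = s`. -/
noncomputable def thetaSum (j : ℤ) (s : ℕ) : ℚ⸨X⸩ :=
  ∑ p ∈ Finset.HasAntidiagonal.antidiagonal s,
    q ^ (((p.1 : ℤ) - p.2) ^ 2 + j * ((p.1 : ℤ) - p.2)) * ((qFact p.1)⁻¹ * (qFact p.2)⁻¹)

theorem thetaSum_zero (j : ℤ) : thetaSum j 0 = 1 := by
  simp [thetaSum, qFact_zero]

theorem thetaSum_neg (j : ℤ) (s : ℕ) : thetaSum (-j) s = thetaSum j s := by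
  rw [thetaSum, ← Finset.Nat.sum_antidiagonal_swap, thetaSum]
  refine Finset.sum_congr rfl fun p _ => ?_
  rw [Prod.fst_swap, Prod.snd_swap, mul_comm (qFact p.2)⁻¹]
  congr 2
  ring

/-- If m + n = s + 1 and k = m - n, then q^(s+1) q^k = q^(2m). Subtracting the first term on the
right thus inserts the factor 1 - q^(2m), which lowers (q²; q²)_m; the shift m ↦ m + 1 then turns j
into j + 2. -/
theorem thetaSum_succ (j : ℤ) (s : ℕ) :
    thetaSum j (s + 1) =
      q ^ (s + 1) * thetaSum (j + 1) (s + 1) + q ^ (1 + j) * thetaSum (j + 2) s := by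
  rw [← sub_eq_iff_eq_add']
  have h : thetaSum j (s + 1) - q ^ (s + 1) * thetaSum (j + 1) (s + 1) =
      ∑ p ∈ Finset.HasAntidiagonal.antidiagonal (s + 1),
        q ^ (((p.1 : ℤ) - p.2) ^ 2 + j * ((p.1 : ℤ) - p.2)) *
          ((1 - q ^ (2 * p.1)) * (qFact p.1)⁻¹ * (qFact p.2)⁻¹) := by
    rw [thetaSum, thetaSum, Finset.mul_sum, ← Finset.sum_sub_distrib]
    refine Finset.sum_congr rfl fun p hp => ?_
    rw [Finset.HasAntidiagonal.mem_antidiagonal] at hp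
    have : q ^ (s + 1) * q ^ (((p.1 : ℤ) - p.2) ^ 2 + (j + 1) * ((p.1 : ℤ) - p.2)) =
        q ^ (((p.1 : ℤ) - p.2) ^ 2 + j * ((p.1 : ℤ) - p.2)) * q ^ (2 * p.1) := by
      rw [← zpow_natCast, ← zpow_natCast, ← zpow_add₀ q_ne_zero, ← zpow_add₀ q_ne_zero, ← hp]
      congr 1
      push_cast
      ring
    rw [← mul_assoc (q ^ (s + 1)), this]
    ring
  rw [h, Finset.Nat.sum_antidiagonal_succ, thetaSum, Finset.mul_sum]
  simp only [mul_zero, pow_zero, sub_self, zero_mul, zero_add, one_sub_mul_inv_qFact_succ]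
  refine Finset.sum_congr rfl fun p _ => ?_
  rw [← mul_assoc (q ^ (1 + j)), ← zpow_add₀ q_ne_zero]
  congr 2
  push_cast
  ring

/-- The generating series of `thetaSum j`. -/
noncomputable def thetaSeries (j : ℤ) : ℚ⸨X⸩⟦X⟧ := PowerSeries.mk (thetaSum j)

theorem thetaSeries_neg (j : ℤ) : thetaSeries (-j) = thetaSeries j := by
  ext1 s
  simp [thetaSeries, thetaSum_neg]

theorem thetaSeries_eq (j : ℤ) :
    thetaSeries j = PowerSeries.rescale q (thetaSeries (j + 1)) +
      PowerSeries.C (q ^ (1 + j)) * (PowerSeries.X * thetaSeries (j + 2)) := by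
  ext1 s
  rw [map_add, PowerSeries.coeff_rescale, PowerSeries.coeff_C_mul]
  cases s with
  | zero => simp [thetaSeries, thetaSum_zero]
  | succ s =>
    rw [PowerSeries.coeff_succ_X_mul]
    simp only [thetaSeries, PowerSeries.coeff_mk]
    exact thetaSum_succ j s

theorem rescale_C (a b : ℚ⸨X⸩) :
    PowerSeries.rescale a (PowerSeries.C b) = PowerSeries.C b := by
  ext1 s
  cases s <;> simp [PowerSeries.coeff_rescale, PowerSeries.coeff_C]

/-- The contiguous relations at j = 0, -1, -2 close up because of the symmetry j ↦ -j. Writing θ_j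
for `thetaSeries j`, they give (1 - z²) θ_0(z) = (1 + qz) θ_1(qz) and (1 - z) θ_1(z) = θ_0(qz); the
latter is used at qz. -/
theorem thetaSeries_zero_functional :
    (1 - PowerSeries.X ^ 2) * (1 - PowerSeries.C q * PowerSeries.X) * thetaSeries 0 =
      (1 + PowerSeries.C q * PowerSeries.X) * PowerSeries.rescale (q ^ 2) (thetaSeries 0) := by
  have h0 : thetaSeries 0 = PowerSeries.rescale q (thetaSeries 1) +
      PowerSeries.C q * (PowerSeries.X * thetaSeries 2) := by
    simpa using thetaSeries_eq 0
  have h1 : thetaSeries 1 = PowerSeries.rescale q (thetaSeries 0) +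
      PowerSeries.X * thetaSeries 1 := by
    simpa [thetaSeries_neg] using thetaSeries_eq (-1)
  have h2 : thetaSeries 2 = PowerSeries.rescale q (thetaSeries 1) +
      PowerSeries.C q⁻¹ * (PowerSeries.X * thetaSeries 0) := by
    rw [← thetaSeries_neg 2, thetaSeries_eq, ← thetaSeries_neg 1]
    norm_num
  have h3 := congrArg (PowerSeries.rescale q) h1
  rw [map_add, map_mul, PowerSeries.rescale_rescale, PowerSeries.rescale_X, ← pow_two] at h3
  have hq : PowerSeries.C q * PowerSeries.C q⁻¹ = (1 : ℚ⸨X⸩⟦X⟧) := by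
    rw [← map_mul, mul_inv_cancel₀ q_ne_zero, map_one]
  linear_combination (1 - PowerSeries.C q * PowerSeries.X) *
      (h0 + PowerSeries.C q * PowerSeries.X * h2 + PowerSeries.X ^ 2 * thetaSeries 0 * hq) +
    (1 + PowerSeries.C q * PowerSeries.X) * h3

/-! ### The Euler series and the three-term recurrence -/

/-- The generating series of `q ^ (m (m - 1)) / (q²; q²)_m`. -/
noncomputable def eulerSeries : ℚ⸨X⸩⟦X⟧ :=
  PowerSeries.mk fun m => q ^ (m * (m - 1)) * (qFact m)⁻¹

theorem eulerSeries_functional :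
    eulerSeries = (1 + PowerSeries.X) * PowerSeries.rescale (q ^ 2) eulerSeries := by
  ext1 m
  rw [add_mul, one_mul, map_add, PowerSeries.coeff_rescale]
  cases m with
  | zero => simp
  | succ m =>
    rw [PowerSeries.coeff_succ_X_mul, PowerSeries.coeff_rescale, ← sub_eq_iff_eq_add']
    simp only [eulerSeries, PowerSeries.coeff_mk, Nat.add_sub_cancel]
    rw [← one_sub_mul_inv_qFact_succ m]
    cases m with
    | zero => simp; ring
    | succ m =>
      simp only [Nat.add_sub_cancel]
      ring

/-- The generating series of the trinomial sums. -/
noncomputable def trinomialSeries : ℚ⸨X⸩⟦X⟧ := eulerSeries * thetaSeries 0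

/-- The factor 1 + z of the Euler series cancels against 1 - z² from the theta series. What remains
is quadratic in z, hence the three-term recurrence for the coefficients. -/
theorem trinomialSeries_functional :
    (1 - PowerSeries.X) * (1 - PowerSeries.C q * PowerSeries.X) * trinomialSeries =
      (1 + PowerSeries.C q * PowerSeries.X) * PowerSeries.rescale (q ^ 2) trinomialSeries := by
  have hne : (1 + PowerSeries.X : ℚ⸨X⸩⟦X⟧) ≠ 0 := fun h => by
    simpa using congrArg (PowerSeries.coeff 0) h
  apply mul_left_cancel₀ hne
  rw [trinomialSeries, map_mul]
  linear_combination eulerSeries * thetaSeries_zero_functional +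
    (1 + PowerSeries.C q * PowerSeries.X) * PowerSeries.rescale (q ^ 2) (thetaSeries 0) *
      eulerSeries_functional

theorem coeff_trinomialSeries_zero : PowerSeries.coeff 0 trinomialSeries = 1 := by
  simp [trinomialSeries, eulerSeries, thetaSeries, thetaSum_zero, qFact_zero]

theorem trinomialSeries_eq :
    trinomialSeries - PowerSeries.X * trinomialSeries -
        PowerSeries.C q * (PowerSeries.X * trinomialSeries) +
        PowerSeries.C q * (PowerSeries.X * (PowerSeries.X * trinomialSeries)) =
      PowerSeries.rescale (q ^ 2) trinomialSeries +
        PowerSeries.C q * (PowerSeries.X * PowerSeries.rescale (q ^ 2) trinomialSeries) := by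
  linear_combination trinomialSeries_functional

theorem coeff_trinomialSeries_one :
    (1 - q ^ 2) * PowerSeries.coeff 1 trinomialSeries = 1 + 2 * q := by
  have h := congrArg (PowerSeries.coeff (0 + 1)) trinomialSeries_eq
  simp only [map_add, map_sub, PowerSeries.coeff_C_mul, PowerSeries.coeff_succ_X_mul,
    PowerSeries.coeff_zero_X_mul, PowerSeries.coeff_rescale, coeff_trinomialSeries_zero] at h
  linear_combination h

theorem coeff_trinomialSeries_add_two (r : ℕ) :
    (1 - q ^ (2 * (r + 2))) * PowerSeries.coeff (r + 2) trinomialSeries =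
      (1 + q * (1 + q ^ (2 * (r + 1)))) * PowerSeries.coeff (r + 1) trinomialSeries -
        q * PowerSeries.coeff r trinomialSeries := by
  have h := congrArg (PowerSeries.coeff (r + 1 + 1)) trinomialSeries_eq
  simp only [map_add, map_sub, PowerSeries.coeff_C_mul, PowerSeries.coeff_succ_X_mul,
    PowerSeries.coeff_rescale] at h
  rw [pow_mul, pow_mul]
  linear_combination h

theorem coeff_trinomialSeries (r : ℕ) :
    PowerSeries.coeff r trinomialSeries =
      ∑ p ∈ Finset.HasAntidiagonal.antidiagonal r, ∑ s ∈ Finset.HasAntidiagonal.antidiagonal p.2,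
        q ^ ((p.1 : ℤ) * (p.1 - 1) + ((s.1 : ℤ) - s.2) ^ 2) *
          ((qFact s.1)⁻¹ * (qFact p.1)⁻¹ * (qFact s.2)⁻¹) := by
  rw [trinomialSeries, PowerSeries.coeff_mul]
  refine Finset.sum_congr rfl fun p _ => ?_
  simp only [eulerSeries, thetaSeries, PowerSeries.coeff_mk, thetaSum, Finset.mul_sum]
  refine Finset.sum_congr rfl fun s _ => ?_
  have h : q ^ (p.1 * (p.1 - 1)) = q ^ ((p.1 : ℤ) * (p.1 - 1)) := by
    rw [← zpow_natCast]
    congr 1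
    cases p.1 <;> simp
  rw [zero_mul, add_zero, zpow_add₀ q_ne_zero, h]
  ring

/-! ### Comparison -/

theorem ofPowerSeries_X : HahnSeries.ofPowerSeries ℤ ℚ PowerSeries.X = q :=
  HahnSeries.ofPowerSeries_X

/-- Eliminating `y` from the system for `x` and `y` gives a second-order recurrence for `x`, which
the right-hand side satisfies with the same two initial values. -/
theorem ofPowerSeries_gapSeries (r : ℕ) :
    HahnSeries.ofPowerSeries ℤ ℚ (gapSeries 1 1 r) =
      q ^ r ^ 2 * PowerSeries.coeff r trinomialSeries := by
  set x : ℕ → ℚ⸨X⸩ := fun r => HahnSeries.ofPowerSeries ℤ ℚ (gapSeries 1 1 r) with hx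
  set y : ℕ → ℚ⸨X⸩ := fun r => HahnSeries.ofPowerSeries ℤ ℚ (gapSeries 0 2 r) with hy
  have x0 : x 0 = 1 := by simp [hx, gapSeries_zero]
  have y0 : y 0 = 1 := by simp [hy, gapSeries_zero]
  have hxs : ∀ r, (1 - q ^ (2 * (r + 1))) * x (r + 1) =
      q ^ (2 * r) * (q * x r + 2 * q ^ 2 * y r) := fun r => by
    simpa only [map_mul, map_sub, map_add, map_one, map_pow, map_ofNat, ofPowerSeries_X] using
      congrArg (HahnSeries.ofPowerSeries ℤ ℚ) (gapSeries_one_succ r)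
  have hys : ∀ r, (1 - q ^ (2 * (r + 1))) * y (r + 1) =
      q ^ (2 * r) * (q ^ 2 * y r + q ^ (2 * r) * (q ^ 3 * x r + q ^ 4 * y r)) := fun r => by
    simpa only [map_mul, map_sub, map_add, map_one, map_pow, map_ofNat, ofPowerSeries_X] using
      congrArg (HahnSeries.ofPowerSeries ℤ ℚ) (gapSeries_zero_succ r)
  change x r = _
  induction r using Nat.twoStepInduction with
  | zero => simp [x0, coeff_trinomialSeries_zero]
  | one =>
    apply mul_left_cancel₀ (one_sub_q_pow_ne_zero 0)
    rw [hxs 0, x0, y0]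
    linear_combination -q * coeff_trinomialSeries_one
  | more r ih1 ih2 =>
    apply mul_left_cancel₀ (one_sub_q_pow_ne_zero (r + 1))
    -- This extra factor is the one multiplying `y (r + 1)` in `hys r`; it allows `y (r + 1)` to be
    -- replaced using `h3`, and then `y r` using `h1`.
    apply mul_left_cancel₀ (one_sub_q_pow_ne_zero r)
    have h1 := hxs r
    have h2 := hxs (r + 1)
    rw [ih1, ih2] at h1
    rw [ih2] at h2
    have h3 := hys r
    rw [ih1] at h3
    linear_combination (1 - q ^ (2 * (r + 1))) * h2 + 2 * q ^ (2 * r + 4) * h3 -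
      q ^ (2 * r + 4) * (1 + q ^ (2 * (r + 1))) * h1 -
      (1 - q ^ (2 * (r + 1))) * q ^ (r + 2) ^ 2 * coeff_trinomialSeries_add_two r

/-! ### The triple sum as a formal sum -/

theorem coeff_genD (r : ℕ) :
    PowerSeries.coeff r (genD (n := 2) (fundamentalWeight 2 1)) =
      HahnSeries.ofPowerSeries ℤ ℚ (gapSeries 1 1 r) := by
  rw [genD, PowerSeries.coeff_mk, gapSeries]
  congr 2
  ext N
  congr 3
  ext lam
  constructor
  · rintro ⟨h, rfl, rfl⟩
    exact (mem_admissibleD_iff lam).1 h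
  · intro h
    obtain ⟨rfl, rfl, -⟩ := id h
    exact ⟨(mem_admissibleD_iff lam).2 h, rfl, rfl⟩

theorem hasFormalSum_of_finset {ι : Type*} {f : ι → ℚ⸨X⸩⟦X⟧} {F : ℚ⸨X⸩⟦X⟧} (S : ℕ → Finset ι)
    (h0 : ∀ r, ∀ i ∉ S r, PowerSeries.coeff r (f i) = 0)
    (hF : ∀ r, ∑ i ∈ S r, PowerSeries.coeff r (f i) = PowerSeries.coeff r F) :
    HasFormalSum f F := by
  intro r N
  have hsub : {i | (PowerSeries.coeff r (f i)).coeff N ≠ 0} ⊆ (S r : Set ι) := fun i hi => by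
    by_contra h
    exact hi (by rw [h0 r i h, HahnSeries.coeff_zero])
  refine ⟨(S r).finite_toSet.subset hsub, ?_⟩
  rw [finsum_eq_sum_of_support_subset _ hsub, ← hF r, HahnSeries.coeff_sum]

theorem HasFormalSum.comp_injective {ι κ : Type*} {f : κ → ℚ⸨X⸩⟦X⟧} {F : ℚ⸨X⸩⟦X⟧}
    (hf : HasFormalSum f F) {e : ι → κ} (he : Function.Injective e)
    (h0 : ∀ k ∉ Set.range e, f k = 0) : HasFormalSum (f ∘ e) F := by
  intro r N
  obtain ⟨h1, h2⟩ := hf r N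
  refine ⟨h1.preimage he.injOn, ?_⟩
  rw [← h2]
  refine (finsum_mem_range he (f := fun k => (PowerSeries.coeff r (f k)).coeff N)).symm.trans ?_
  refine finsum_congr fun k => ?_
  by_cases hk : k ∈ Set.range e
  · simp [hk]
  · simp [hk, h0 k hk]

/-- The index `(m₁ + m₂ + m₃, m₂ + m₃, m₃)` of the triple sum. -/
def tripleIndex (m : ℕ × ℕ × ℕ) : Fin 3 → ℕ := ![m.1 + m.2.1 + m.2.2, m.2.1 + m.2.2, m.2.2]

theorem tripleIndex_injective : Function.Injective tripleIndex := by
  rintro ⟨a, b, c⟩ ⟨a', b', c'⟩ h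
  have h0 := congrFun h 0
  have h1 := congrFun h 1
  have h2 := congrFun h 2
  simp [tripleIndex] at h0 h1 h2
  simp only [Prod.mk.injEq]
  omega

theorem mem_range_tripleIndex {r : Fin 3 → ℕ} (h1 : r 1 ≤ r 0) (h2 : r 2 ≤ r 1) :
    r ∈ Set.range tripleIndex := by
  refine ⟨(r 0 - r 1, r 1 - r 2, r 2), ?_⟩
  ext i
  fin_cases i <;> simp [tripleIndex] <;> omega

theorem invQFactorial_natCast (m : ℕ) : invQFactorial (q ^ 2) (m : ℤ) = (qFact m)⁻¹ := by
  simp [invQFactorial]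

theorem tripleTerm_eq_zero {r : Fin 3 → ℕ} (h : ¬ (r 1 ≤ r 0 ∧ r 2 ≤ r 1)) : tripleTerm r = 0 := by
  have : invQFactorial (q ^ 2) ((r 0 : ℤ) - r 1) * invQFactorial (q ^ 2) ((r 1 : ℤ) - r 2) = 0 := by
    by_cases h1 : r 1 ≤ r 0
    · rw [invQFactorial, invQFactorial, if_neg (by omega : ¬ 0 ≤ (r 1 : ℤ) - r 2), mul_zero]
    · rw [invQFactorial, if_neg (by omega), zero_mul]
  rw [tripleTerm, this, zero_mul, mul_zero, map_zero, mul_zero]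

/-- Completing the square in a + b + c separates b from the difference a - c, matching the product
of the Euler and theta series. -/
theorem tripleTerm_tripleIndex (a b c : ℕ) :
    tripleTerm (tripleIndex (a, b, c)) =
      PowerSeries.X ^ (a + b + c) * PowerSeries.C (q ^ (a + b + c) ^ 2 *
        (q ^ ((b : ℤ) * (b - 1) + ((a : ℤ) - c) ^ 2) *
          ((qFact a)⁻¹ * (qFact b)⁻¹ * (qFact c)⁻¹))) := by
  simp only [tripleTerm, tripleIndex, Matrix.cons_val_zero, Matrix.cons_val_one,
    Matrix.cons_val]
  have h1 : ((a + b + c : ℕ) : ℤ) - (b + c : ℕ) = (a : ℕ) := by push_cast; ring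
  have h2 : ((b + c : ℕ) : ℤ) - (c : ℕ) = (b : ℕ) := by push_cast; ring
  rw [h1, h2, invQFactorial_natCast, invQFactorial_natCast, invQFactorial_natCast,
    ← mul_assoc (q ^ (a + b + c) ^ 2), ← zpow_natCast q, ← zpow_add₀ q_ne_zero]
  congr 4
  push_cast
  ring

theorem hasFormalSum_tripleTerm :
    HasFormalSum tripleTerm (genD (n := 2) (fundamentalWeight 2 1)) := by
  classical
  refine hasFormalSum_of_finset (fun r => ((Finset.HasAntidiagonal.antidiagonal r).sigma
    fun p => Finset.HasAntidiagonal.antidiagonal p.2).image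
      fun x => tripleIndex (x.2.1, x.1.1, x.2.2)) ?_ ?_
  · intro r i hi
    by_cases h : i 1 ≤ i 0 ∧ i 2 ≤ i 1
    · obtain ⟨⟨a, b, c⟩, rfl⟩ := mem_range_tripleIndex h.1 h.2
      rw [tripleTerm_tripleIndex, PowerSeries.coeff_X_pow_mul', PowerSeries.coeff_C]
      have hne : r ≠ a + b + c := by
        rintro rfl
        refine hi (Finset.mem_image.2 ⟨⟨(b, a + c), (a, c)⟩, ?_, rfl⟩)
        simp only [Finset.mem_sigma, Finset.HasAntidiagonal.mem_antidiagonal, and_true]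
        omega
      split_ifs <;> first | rfl | omega
    · rw [tripleTerm_eq_zero h, map_zero]
  · intro r
    rw [Finset.sum_image, Finset.sum_sigma, coeff_genD, ofPowerSeries_gapSeries,
      coeff_trinomialSeries, Finset.mul_sum]
    · refine Finset.sum_congr rfl fun p hp => ?_
      rw [Finset.mul_sum]
      refine Finset.sum_congr rfl fun s hs => ?_
      rw [Finset.HasAntidiagonal.mem_antidiagonal] at hp hs
      have hr : s.1 + p.1 + s.2 = r := by omega
      rw [tripleTerm_tripleIndex, hr, PowerSeries.coeff_X_pow_mul', if_pos le_rfl, Nat.sub_self,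
        PowerSeries.coeff_zero_C]
    · rintro ⟨⟨b, m⟩, a, c⟩ hx ⟨⟨b', m'⟩, a', c'⟩ hx' h
      have := tripleIndex_injective h
      simp only [Finset.coe_sigma, Set.mem_sigma_iff, Finset.mem_coe,
        Finset.HasAntidiagonal.mem_antidiagonal] at hx hx'
      simp only [Prod.mk.injEq] at this
      obtain ⟨rfl, rfl, rfl⟩ := this
      obtain rfl : m = m' := by omega
      rfl

/-! ### The Hall--Littlewood sum -/

/-- The index of the triple sum that belongs to a chain of partitions. -/
def chainIndex (μ : partitionChains 1 2) : Fin 3 → ℕ :=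
  ![(μ.1 0).rowLen 0, (μ.1 1).rowLen 0, (μ.1 1).rowLen 1]

theorem rowLen_eq_zero {μ : YoungDiagram} (h : μ.colLen 0 ≤ 2) {i : ℕ} (hi : 2 ≤ i) :
    μ.rowLen i = 0 := by
  by_contra hne
  have h1 : (i, 0) ∈ μ := YoungDiagram.mem_iff_lt_rowLen.2 (Nat.pos_of_ne_zero hne)
  have := YoungDiagram.mem_iff_lt_colLen.1 h1
  omega

/-- A nonempty column of even length has at least two cells, so it reaches the second row. -/
theorem rowLen_one_eq {μ : YoungDiagram} (h : ∀ j, Even (μ.colLen j)) :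
    μ.rowLen 1 = μ.rowLen 0 := by
  refine eq_of_forall_lt_iff fun j => ?_
  rw [← YoungDiagram.mem_iff_lt_rowLen, ← YoungDiagram.mem_iff_lt_rowLen,
    YoungDiagram.mem_iff_lt_colLen, YoungDiagram.mem_iff_lt_colLen]
  obtain ⟨m, hm⟩ := h j
  omega

theorem rowLen_le_rowLen {μ ν : YoungDiagram} (h : μ ≤ ν) (i : ℕ) : μ.rowLen i ≤ ν.rowLen i := by
  refine le_of_forall_lt fun j hj => ?_
  rw [← YoungDiagram.mem_iff_lt_rowLen] at *
  exact h hj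

theorem colLen_le_colLen {μ ν : YoungDiagram} (h : μ ≤ ν) (j : ℕ) : μ.colLen j ≤ ν.colLen j := by
  refine le_of_forall_lt fun i hi => ?_
  rw [← YoungDiagram.mem_iff_lt_colLen] at *
  exact h hi

theorem ext_rowLen {μ ν : YoungDiagram} (h : ∀ i, μ.rowLen i = ν.rowLen i) : μ = ν := by
  ext ⟨i, j⟩
  rw [YoungDiagram.mem_cells, YoungDiagram.mem_cells, YoungDiagram.mem_iff_lt_rowLen, h,
    YoungDiagram.mem_iff_lt_rowLen]

theorem partitionChains_rowLen {μ : Fin 3 → YoungDiagram} (hμ : μ ∈ partitionChains 1 2) :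
    μ 1 ≤ μ 0 ∧ μ 2 = ⊥ ∧ (μ 0).rowLen 1 = (μ 0).rowLen 0 ∧
      (∀ i, 2 ≤ i → (μ 0).rowLen i = 0) ∧ ∀ i, 2 ≤ i → (μ 1).rowLen i = 0 := by
  obtain ⟨h1, h2, h3, h4⟩ := hμ
  have h10 : μ 1 ≤ μ 0 := h1 (by decide)
  exact ⟨h10, h2, rowLen_one_eq h3, fun i => rowLen_eq_zero h4,
    fun i => rowLen_eq_zero ((colLen_le_colLen h10 0).trans h4)⟩

theorem chainIndex_injective : Function.Injective chainIndex := by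
  rintro ⟨μ, hμ⟩ ⟨ν, hν⟩ h
  have h0 : (μ 0).rowLen 0 = (ν 0).rowLen 0 := congrFun h 0
  have h1 : (μ 1).rowLen 0 = (ν 1).rowLen 0 := congrFun h 1
  have h2 : (μ 1).rowLen 1 = (ν 1).rowLen 1 := congrFun h 2
  obtain ⟨-, m2, m3, m4, m5⟩ := partitionChains_rowLen hμ
  obtain ⟨-, n2, n3, n4, n5⟩ := partitionChains_rowLen hν
  refine Subtype.ext (funext fun a => ?_)
  fin_cases a
  · refine ext_rowLen fun i => ?_
    rcases i with _ | _ | i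
    · exact h0
    · exact m3.trans (h0.trans n3.symm)
    · exact (m4 _ (by omega)).trans (n4 _ (by omega)).symm
  · refine ext_rowLen fun i => ?_
    rcases i with _ | _ | i
    · exact h1
    · exact h2
    · exact (m5 _ (by omega)).trans (n5 _ (by omega)).symm
  · exact m2.trans n2.symm

/-- The Young diagram with rows of lengths `a ≥ b`. -/
def twoRows (a b : ℕ) (_h : b ≤ a) : YoungDiagram where
  cells := (Finset.range 2 ×ˢ Finset.range a).filter fun x => x.1 = 1 → x.2 < b
  isLowerSet := by
    rintro ⟨i, j⟩ ⟨i', j'⟩ hle hmem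
    obtain ⟨hi, hj⟩ := Prod.mk_le_mk.1 hle
    simp at hmem ⊢
    omega

theorem mem_twoRows {a b : ℕ} (h : b ≤ a) (i j : ℕ) :
    (i, j) ∈ twoRows a b h ↔ i = 0 ∧ j < a ∨ i = 1 ∧ j < b := by
  rw [← YoungDiagram.mem_cells, twoRows]
  simp
  omega

theorem rowLen_twoRows {a b : ℕ} (h : b ≤ a) (i : ℕ) :
    (twoRows a b h).rowLen i = if i = 0 then a else if i = 1 then b else 0 := by
  refine eq_of_forall_lt_iff fun j => ?_
  rw [← YoungDiagram.mem_iff_lt_rowLen, mem_twoRows]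
  split_ifs <;> omega

theorem colLen_twoRows {a b : ℕ} (h : b ≤ a) (j : ℕ) :
    (twoRows a b h).colLen j = if j < b then 2 else if j < a then 1 else 0 := by
  refine eq_of_forall_lt_iff fun i => ?_
  rw [← YoungDiagram.mem_iff_lt_colLen, mem_twoRows]
  split_ifs <;> omega

theorem mem_range_chainIndex {r : Fin 3 → ℕ} (h1 : r 1 ≤ r 0) (h2 : r 2 ≤ r 1) :
    r ∈ Set.range chainIndex := by
  have hle : twoRows (r 1) (r 2) h2 ≤ twoRows (r 0) (r 0) le_rfl := by
    rintro ⟨i, j⟩ h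
    rw [mem_twoRows] at *
    omega
  refine ⟨⟨![twoRows (r 0) (r 0) le_rfl, twoRows (r 1) (r 2) h2, ⊥], ?_, rfl, ?_, ?_⟩, ?_⟩
  · intro a b hab
    fin_cases a <;> fin_cases b <;> simp_all
  · intro j
    simp only [Matrix.cons_val_zero, colLen_twoRows]
    split_ifs <;> decide
  · simp only [Matrix.cons_val_zero, colLen_twoRows]
    split_ifs <;> omega
  · ext i
    fin_cases i <;> simp [chainIndex, rowLen_twoRows]

theorem qBinomial_eq {m l : ℕ} (h : l ≤ m) :
    qBinomial (q ^ 2) m l = qFact m * (qFact l)⁻¹ * (qFact (m - l))⁻¹ := by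
  rw [qBinomial, if_pos h, div_eq_mul_inv, mul_inv, mul_assoc]

theorem sq_pow_choose_two (m : ℕ) : (q ^ 2) ^ m.choose 2 = q ^ ((m : ℤ) * (m - 1)) := by
  rw [← pow_mul, ← zpow_natCast, Nat.choose_two_right,
    Nat.mul_div_cancel' (Nat.even_mul_pred_self m).two_dvd]
  congr 1
  cases m <;> simp

theorem qBinomial_self (m : ℕ) : qBinomial (q ^ 2) m m = 1 := by
  rw [qBinomial_eq le_rfl, Nat.sub_self, qFact_zero, inv_one, mul_one,
    mul_inv_cancel₀ (qFact_ne_zero m)]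

/-- The Hall–Littlewood summand depends on z only through zq, so z ↦ z/q leaves a pure power of z.
-/
theorem substZDivQ_X_mul_C_pow_mul_C (m : ℕ) (a : ℚ⸨X⸩) :
    substZDivQ ((PowerSeries.X * PowerSeries.C q) ^ m * PowerSeries.C a) =
      PowerSeries.X ^ m * PowerSeries.C a := by
  have : PowerSeries.C q⁻¹ * PowerSeries.X * PowerSeries.C q = (PowerSeries.X : ℚ⸨X⸩⟦X⟧) := by
    rw [mul_right_comm, ← map_mul, inv_mul_cancel₀ q_ne_zero, map_one, one_mul]
  rw [substZDivQ, map_mul, map_pow, map_mul, rescale_C, rescale_C, PowerSeries.rescale_X, this]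

/-- With μ^(0) = (a, a) and μ^(1) = (b, c), the factor 1/(t;t)_a and the binomials [a - c, a - b]
and [a, a - c] telescope to 1/((t;t)_{a-b} (t;t)_{b-c} (t;t)_c); the binomials with a = 2 in the
inner product are 1. -/
theorem weightedHLTerm_eq (μ : partitionChains 1 2) :
    weightedHLTerm 2 μ.1 = tripleTerm (chainIndex μ) := by
  obtain ⟨μ, hμ⟩ := μ
  obtain ⟨h10, h2, h3, h4, h5⟩ := partitionChains_rowLen hμ
  have hbc : (μ 1).rowLen 1 ≤ (μ 1).rowLen 0 := YoungDiagram.rowLen_anti _ _ _ zero_le_one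
  have hab := rowLen_le_rowLen h10 0
  have hbot : ∀ i, (⊥ : YoungDiagram).rowLen i = 0 := fun i => by
    by_contra hne
    exact YoungDiagram.notMem_bot _ (YoungDiagram.mem_iff_lt_rowLen.2 (Nat.pos_of_ne_zero hne))
  simp only [weightedHLTerm, hlTerm, tripleTerm, chainIndex, Fin.prod_univ_two,
    Finset.prod_range_succ, Finset.prod_range_zero, Finset.sum_range_succ, Finset.sum_range_zero]
  have f1 : Fin.ofNat (2 + 1) 1 = 1 := rfl
  have f2 : (0 : Fin 2).castSucc = 0 := rfl
  have f3 : (1 : Fin 2).castSucc = 1 := rfl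
  have f4 : (0 : Fin 2).succ = 1 := rfl
  have f5 : (1 : Fin 2).succ = 2 := rfl
  simp only [f1, f2, f3, f4, f5, h2, hbot, h3, h4 2 le_rfl, h5 2 le_rfl, zero_add, Nat.reduceAdd,
    Nat.sub_zero, Nat.sub_self, Matrix.cons_val_zero, Matrix.cons_val_one, Matrix.cons_val]
  generalize (μ 0).rowLen 0 = a at *
  generalize (μ 1).rowLen 0 = b at *
  generalize (μ 1).rowLen 1 = c at *
  rw [substZDivQ_X_mul_C_pow_mul_C, mul_left_comm, ← map_mul, ← two_mul,
    Nat.mul_div_cancel_left _ two_pos]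
  obtain ⟨e, rfl⟩ := Nat.exists_eq_add_of_le' hbc
  obtain ⟨d, rfl⟩ := Nat.exists_eq_add_of_le' hab
  have g1 : d + (e + c) - c = d + e := by omega
  have g2 : ((d + (e + c) : ℕ) : ℤ) - (e + c : ℕ) = (d : ℕ) := by push_cast; ring
  have g3 : ((e + c : ℕ) : ℤ) - (c : ℕ) = (e : ℕ) := by push_cast; ring
  have g4 : d + (e + c) - (d + e) = c := by omega
  have g5 : d + e - d = e := by omega
  rw [qBinomial_eq (by omega : d + (e + c) - c ≤ d + (e + c))]
  simp only [Nat.add_sub_cancel, g1]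
  rw [qBinomial_eq (by omega : d ≤ d + e)]
  simp only [qBinomial_self, sq_pow_choose_two, g2, g3, g4, g5, invQFactorial_natCast, pow_zero]
  have hq : q ^ ((d : ℤ) ^ 2 + ((d + (e + c) : ℕ) - (c : ℕ)) ^ 2 + (e + c : ℕ) ^ 2 + (c : ℕ) ^ 2 -
      (e + c : ℕ) + (c : ℕ)) =
      q ^ (((2 : ℕ) : ℤ) * (d + (e + c) : ℕ) - ((2 : ℕ) : ℤ) * (e + c : ℕ)) *
        q ^ (e + c) * q ^ ((d : ℤ) * (d - 1)) * q ^ (((e + c : ℕ) : ℤ) * ((e + c : ℕ) - 1)) *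
        q ^ c * q ^ (((d + e : ℕ) : ℤ) * ((d + e : ℕ) - 1)) * q ^ ((c : ℤ) * (c - 1)) := by
    rw [← zpow_natCast q (e + c), ← zpow_natCast q c]
    simp only [← zpow_add₀ q_ne_zero]
    congr 1
    push_cast
    ring
  rw [hq]
  have n1 := mul_inv_cancel₀ (qFact_ne_zero (d + e))
  have n2 := mul_inv_cancel₀ (qFact_ne_zero (d + (e + c)))
  have n3 : (qPochhammer (q ^ 2) (q ^ 2) 0)⁻¹ = 1 := by rw [← qFact, qFact_zero, inv_one]
  rw [n3]
  congr 2
  generalize q ^ (((2 : ℕ) : ℤ) * (d + (e + c) : ℕ) - ((2 : ℕ) : ℤ) * (e + c : ℕ)) = x1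
  generalize q ^ (((d + e : ℕ) : ℤ) * ((d + e : ℕ) - 1)) = x2
  generalize q ^ (((e + c : ℕ) : ℤ) * ((e + c : ℕ) - 1)) = x3
  generalize q ^ ((d : ℤ) * (d - 1)) = x4
  generalize q ^ ((c : ℤ) * (c - 1)) = x5
  -- The two factorials that telescope are those of `d + e` (cancelled by `n1`) and `d + (e + c)`
  -- (cancelled by `n2`).
  linear_combination x1 * x2 * x3 * x4 * x5 * q ^ (e + c) * q ^ c *
    ((qFact d)⁻¹ * (qFact e)⁻¹ * (qFact c)⁻¹) *
      (n1 + qFact (d + e) * (qFact (d + e))⁻¹ * n2)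

end CMPP

theorem mainTheorem12 :
    CMPP.HasFormalSum
      (fun μ : CMPP.partitionChains 1 2 => CMPP.weightedHLTerm 2 μ.1)
      (CMPP.genD (CMPP.fundamentalWeight 2 1)) ∧
    CMPP.HasFormalSum CMPP.tripleTerm
      (CMPP.genD (CMPP.fundamentalWeight 2 1)) := by
  refine ⟨?_, CMPP.hasFormalSum_tripleTerm⟩
  simp only [CMPP.weightedHLTerm_eq]
  refine CMPP.hasFormalSum_tripleTerm.comp_injective CMPP.chainIndex_injective fun r hr =>
    CMPP.tripleTerm_eq_zero fun h => hr (CMPP.mem_range_chainIndex h.1 h.2)
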